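/- Conventions. A standard complex Gaussian variable is one with the law of $(x+\mathrm{i}y)/\sqrt2$, where $x,y$ are independent real $\mathcal N(0,1)$ variables. Let $$h_k(t)=\frac{(-1)^k}{\sqrt{\sqrt{\pi}\,2^k k!}}\,e^{t^2/2}\,\frac{\mathrm d^k}{\mathrm dt^k}e^{-t^2},\qquad k\in\mathbb N,$$ be the Hermite functions, a Hilbert basis of $L^2(\mathbb R)$, and let $\mathfrak G$ be the completion of $L^2(\mathbb R)$ for the norm $\|s\|_{\mathfrak G}^2=\sum_{k\ge 0}|\langle s,h_k\rangle|^2/(1+k^2)$. Let $g(t)=\pi^{-1/4}e^{-t^2/2}$ be the (unit energy) circular Gaussian window and, for $s\in L^2(\mathbb R)$, $$\mathcal V_g s(t,\omega)=\int_{\mathbb R}s(u)\,\overline{g(u-t)}\,e^{-\mathrm{i}\omega u}\,\mathrm du .$$ Identify the time-frequency plane with $\mathbb C$ through $z=\omega+\mathrm{i}t$, and equip the space $C(\mathbb C)$ of continuous functions $\mathbb C\to\mathbb C$ with the topology of uniform convergence on compact sets. For $\gamma>0$ and i.i.d. standard complex Gaussian variables $(\eta_k)_{k\ge0}$, the planar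 Gaussian Analytic Function of parameter $\gamma$ is $\mathsf{GAF}_{\mathbb C}^{(\gamma)}(z)=\sum_{k\ge0}\eta_k\sqrt{\gamma^k/k!}\;z^k$. Proposition. Let $(\xi_k)_{k\ge0}$ be i.i.d. standard complex Gaussian variables. 1. The series $\xi=\sum_{k\ge0}\xi_kh_k$ (white noise) converges almost surely in $\mathfrak G$; the map $s\mapsto\big(z\mapsto\mathcal V_gs(t,\omega)\big)$ extends to a continuous map from $\mathfrak G$ to $C(\mathbb C)$, which defines $\mathcal V_g\xi$; and the series defining $\mathsf{GAF}_{\mathbb C}^{(1/2)}$ almost surely converges at every $z\in\mathbb C$ to an entire function. 2. The random function $z=\omega+\mathrm{i}t\mapsto\mathcal V_g\xi(t,\omega)$ has the same distribution, on $C(\mathbb C)$ with its Borel $\sigma$-algebra, as $$z\mapsto\psi(z)\,\mathsf{GAF}_{\mathbb C}^{(1/2)}(z),\qquad \psi(z)=\exp\!\Big(-\frac{|z|^2}{4}-\frac{\mathrm{i}\omega t}{2}\Big),$$ and the deterministic function $\psi$ vanishes nowhere. 3. Consequently the zeros of the Gaussian spectrogram $|\mathcal V_g\xi|^2$ of white noise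 are exactly the zeros of a planar Gaussian Analytic Function: there are i.i.d. standard complex Gaussian variables $(\zeta_k)_{k\ge0}$, on the same probability space as $\xi$, such that, almost surely, for all $z=\omega+\mathrm{i}t\in\mathbb C$, $\mathcal V_g\xi(t,\omega)=\psi(z)\sum_{k\ge0}\zeta_k\sqrt{2^{-k}/k!}\;z^k$, so that the zero set of the spectrogram coincides almost surely with the zero set of this planar Gaussian Analytic Function. In particular the zeros of the spectrogram and the zeros of any $\mathsf{GAF}_{\mathbb C}^{(1/2)}$ have the same law as point processes. -/

import Mathlib

open MeasureTheory ProbabilityTheory Filter Topology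
open scoped ComplexConjugate Nat

noncomputable section

namespace WhiteNoise

/-- The Hermite function of order `k`. -/
def hermiteFun (k : ℕ) (t : ℝ) : ℝ :=
  (-1) ^ k / √(√Real.pi * 2 ^ k * (k ! : ℝ)) * Real.exp (t ^ 2 / 2)
    * iteratedDeriv k (fun x : ℝ => Real.exp (-x ^ 2)) t

/-- The polynomial factor of the `k`-th Hermite function (auxiliary). -/
def hermPoly : ℕ → Polynomial ℝ
  | 0 => 1
  | n + 1 => 2 * Polynomial.X * hermPoly n - Polynomial.derivative (hermPoly n)

lemma hermPoly_derivative (n : ℕ) :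
    Polynomial.derivative (hermPoly (n + 1)) = (2 * (n + 1) : ℕ) * hermPoly n := by
  induction n with
  | zero => simp [hermPoly]
  | succ n ih =>
    have h2 : hermPoly (n + 1) = 2 * Polynomial.X * hermPoly n - Polynomial.derivative (hermPoly n) := rfl
    have h : hermPoly (n + 2) = 2 * Polynomial.X * hermPoly (n + 1)
      - Polynomial.derivative (hermPoly (n + 1)) := rfl
    rw [h, ih]
    simp only [Polynomial.derivative_sub, Polynomial.derivative_mul, Polynomial.derivative_X,
      Polynomial.derivative_natCast, ih]
    simp only [Polynomial.derivative_ofNat]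
    rw [h2]
    push_cast
    ring

lemma hasDerivAt_gauss (p : Polynomial ℝ) (x : ℝ) :
    HasDerivAt (fun x : ℝ => p.eval x * Real.exp (-x ^ 2))
      (-((2 * Polynomial.X * p - Polynomial.derivative p).eval x * Real.exp (-x ^ 2))) x := by
  have h1 : HasDerivAt (fun x : ℝ => Real.exp (-x ^ 2)) (Real.exp (-x ^ 2) * (-(2 * x))) x := by
    have : HasDerivAt (fun x : ℝ => -x ^ 2) (-(2 * x)) x := by
      simpa using! (hasDerivAt_pow 2 x).neg
    exact this.exp
  have := (p.hasDerivAt x).mul h1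
  convert! this using 1
  simp
  ring

lemma iteratedDeriv_gauss (n : ℕ) :
    iteratedDeriv n (fun x : ℝ => Real.exp (-x ^ 2))
      = fun x => (-1) ^ n * ((hermPoly n).eval x * Real.exp (-x ^ 2)) := by
  induction n with
  | zero => ext x; simp [hermPoly]
  | succ n ih =>
    rw [iteratedDeriv_succ, ih]
    ext x
    rw [((hasDerivAt_gauss (hermPoly n) x).const_mul _).deriv, hermPoly, pow_succ]
    ring

lemma hermiteFun_eq (k : ℕ) (t : ℝ) :
    hermiteFun k t = (√(√Real.pi * 2 ^ k * (k ! : ℝ)))⁻¹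
      * ((hermPoly k).eval t * Real.exp (-(1 / 2) * t ^ 2)) := by
  rw [hermiteFun, iteratedDeriv_gauss]
  have h1 : Real.exp (-(1 / 2) * t ^ 2) = Real.exp (t ^ 2 / 2) * Real.exp (-t ^ 2) := by
    rw [← Real.exp_add]; ring_nf
  have h2 : ((-1 : ℝ) ^ k) * (-1) ^ k = 1 := by rw [← mul_pow]; simp
  rw [h1]
  linear_combination (√(√Real.pi * 2 ^ k * (k ! : ℝ)))⁻¹ * (Real.exp (t ^ 2 / 2)) *
    ((hermPoly k).eval t * Real.exp (-t ^ 2)) * h2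

lemma integrable_poly_gauss (p : Polynomial ℝ) {b : ℝ} (hb : 0 < b) :
    Integrable (fun x : ℝ => p.eval x * Real.exp (-b * x ^ 2)) := by
  induction p using Polynomial.induction_on' with
  | add p q hp hq => simpa [add_mul] using! hp.add hq
  | monomial n a =>
    have := (integrable_rpow_mul_exp_neg_mul_sq hb (s := n)
      (by have : (0 : ℝ) ≤ n := Nat.cast_nonneg n
          linarith)).const_mul a
    simpa [mul_assoc] using this

lemma integrable_poly_gauss_one (p : Polynomial ℝ) :
    Integrable (fun x : ℝ => p.eval x * Real.exp (-x ^ 2)) := by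
  simpa using integrable_poly_gauss p one_pos

lemma integral_hermPoly_succ (p : Polynomial ℝ) (n : ℕ) :
    ∫ x : ℝ, p.eval x * ((hermPoly (n + 1)).eval x * Real.exp (-x ^ 2))
      = ∫ x : ℝ, (Polynomial.derivative p).eval x * ((hermPoly n).eval x * Real.exp (-x ^ 2)) := by
  have key (q r : Polynomial ℝ) :
      Integrable (fun x : ℝ => q.eval x * (r.eval x * Real.exp (-x ^ 2))) := by
    simpa [mul_assoc] using integrable_poly_gauss_one (q * r)
  have := integral_mul_deriv_eq_deriv_mul_of_integrable
    (u := fun x => p.eval x) (u' := fun x => (Polynomial.derivative p).eval x)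
    (v := fun x => (hermPoly n).eval x * Real.exp (-x ^ 2))
    (v' := fun x => -((hermPoly (n + 1)).eval x * Real.exp (-x ^ 2)))
    (fun x _ => p.hasDerivAt x) (fun x _ => hasDerivAt_gauss (hermPoly n) x)
    (by simpa [Pi.mul_def] using (key p (hermPoly (n + 1))).neg)
    (key _ _) (key _ _)
  simp only [mul_neg, integral_neg, neg_inj] at this
  exact this

lemma integral_hermPoly_mul (m n : ℕ) :
    ∫ x : ℝ, (hermPoly m).eval x * ((hermPoly n).eval x * Real.exp (-x ^ 2))
      = if m = n then √Real.pi * 2 ^ n * (n ! : ℝ) else 0 := by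
  induction n generalizing m with
  | zero =>
    cases m with
    | zero =>
      have := integral_gaussian 1
      simpa [hermPoly] using this
    | succ m =>
      have := integral_hermPoly_succ 1 m
      simp only [Polynomial.eval_one, one_mul, Polynomial.derivative_one, Polynomial.eval_zero,
        zero_mul, integral_zero] at this
      simpa [hermPoly] using this
  | succ n ih =>
    rw [integral_hermPoly_succ]
    cases m with
    | zero => simp [hermPoly]
    | succ m =>
      have h (x : ℝ) : (Polynomial.derivative (hermPoly (m + 1))).eval x
          * ((hermPoly n).eval x * Real.exp (-x ^ 2))
          = (2 * ((m : ℝ) + 1)) * ((hermPoly m).eval x * ((hermPoly n).eval x * Real.exp (-x ^ 2))) := by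
        rw [hermPoly_derivative]
        simp only [Polynomial.eval_mul, Polynomial.eval_natCast]
        push_cast
        ring
      simp_rw [h]
      rw [integral_const_mul, ih]
      by_cases hmn : m = n
      · subst hmn
        simp only [if_true, Nat.factorial_succ]
        push_cast
        ring
      · simp [hmn]

lemma continuous_hermiteFun (k : ℕ) : Continuous (hermiteFun k) := by
  rw [funext (hermiteFun_eq k)]
  fun_prop

lemma hermiteFun_mul (m n : ℕ) (t : ℝ) :
    hermiteFun m t * hermiteFun n t = (√(√Real.pi * 2 ^ m * (m ! : ℝ)))⁻¹
      * (√(√Real.pi * 2 ^ n * (n ! : ℝ)))⁻¹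
      * ((hermPoly m).eval t * ((hermPoly n).eval t * Real.exp (-t ^ 2))) := by
  have h1 : Real.exp (-t ^ 2) = Real.exp (-(1 / 2) * t ^ 2) * Real.exp (-(1 / 2) * t ^ 2) := by
    rw [← Real.exp_add]; ring_nf
  rw [hermiteFun_eq, hermiteFun_eq, h1]
  ring

lemma integrable_hermiteFun_mul (m n : ℕ) :
    Integrable (fun t => hermiteFun m t * hermiteFun n t) := by
  simp_rw [hermiteFun_mul]
  apply Integrable.const_mul
  simpa [mul_assoc] using integrable_poly_gauss_one (hermPoly m * hermPoly n)

lemma integral_hermiteFun_mul (m n : ℕ) :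
    ∫ t, hermiteFun m t * hermiteFun n t = if m = n then 1 else 0 := by
  simp_rw [hermiteFun_mul]
  rw [integral_const_mul, integral_hermPoly_mul]
  by_cases h : m = n
  · subst h
    have hp : 0 < √Real.pi * 2 ^ m * (m ! : ℝ) := by positivity
    simp only [if_true]
    rw [← mul_inv, Real.mul_self_sqrt hp.le]
    exact inv_mul_cancel₀ hp.ne'
  · simp [h]

lemma memLp_hermiteFun (k : ℕ) :
    MemLp (fun t : ℝ => (hermiteFun k t : ℂ)) 2 volume := by
  have : MemLp (hermiteFun k) 2 volume := by
    rw [memLp_two_iff_integrable_sq (continuous_hermiteFun k).aestronglyMeasurable]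
    simpa [sq] using integrable_hermiteFun_mul k k
  exact this.ofReal

/-- The Hilbert space `L²(ℝ)` of finite-energy complex signals. -/
abbrev Signal : Type := Lp ℂ 2 (volume : Measure ℝ)

/-- The Hermite function of order `k` as an element of `L²(ℝ)`. -/
def hermiteSignal (k : ℕ) : Signal := (memLp_hermiteFun k).toLp _

lemma inner_hermiteSignal (k : ℕ) (s : Signal) :
    inner ℂ (hermiteSignal k) s = ∫ t, (hermiteFun k t : ℂ) * s t := by
  rw [L2.inner_def]
  apply integral_congr_ae
  filter_upwards [(memLp_hermiteFun k).coeFn_toLp] with t ht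
  rw [hermiteSignal, ht]
  simp [mul_comm]

lemma orthonormal_hermiteSignal : Orthonormal ℂ hermiteSignal := by
  rw [orthonormal_iff_ite]
  intro m n
  rw [inner_hermiteSignal]
  have : ∫ t, (hermiteFun m t : ℂ) * (hermiteSignal n) t
      = ∫ t, ((hermiteFun m t * hermiteFun n t : ℝ) : ℂ) := by
    apply integral_congr_ae
    filter_upwards [(memLp_hermiteFun n).coeFn_toLp] with t ht
    rw [hermiteSignal, ht]
    simp
  rw [this, integral_complex_ofReal, integral_hermiteFun_mul]
  split_ifs <;> simp


lemma memLp_of_sq {f : ℝ → ℝ} (hf : Continuous f) (h : Integrable (fun x => f x ^ 2)) :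
    MemLp (fun x => (f x : ℂ)) 2 volume :=
  ((memLp_two_iff_integrable_sq hf.aestronglyMeasurable).2 h).ofReal

lemma integrable_mul_signal {f : ℝ → ℂ} (hf : MemLp f 2 volume) (s : Signal) :
    Integrable (fun x => f x * s x) :=
  hf.integrable_mul (Lp.memLp s)

lemma memLp_poly_gauss (p : Polynomial ℝ) :
    MemLp (fun x : ℝ => ((p.eval x * Real.exp (-(1 / 2) * x ^ 2) : ℝ) : ℂ)) 2 volume := by
  refine memLp_of_sq (by fun_prop) ?_
  refine (integrable_poly_gauss_one (p ^ 2)).congr (ae_of_all _ fun x => ?_)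
  have h1 : Real.exp (-x ^ 2) = Real.exp (-(1 / 2) * x ^ 2) * Real.exp (-(1 / 2) * x ^ 2) := by
    rw [← Real.exp_add]; ring_nf
  simp only [Polynomial.eval_pow, h1]
  ring

/-- The pairing of a signal with a polynomial times a Gaussian (auxiliary). -/
def polyPairing (s : Signal) : Polynomial ℝ →ₗ[ℝ] ℂ where
  toFun p := ∫ x : ℝ, ((p.eval x * Real.exp (-(1 / 2) * x ^ 2) : ℝ) : ℂ) * s x
  map_add' p q := by
    rw [← integral_add (integrable_mul_signal (memLp_poly_gauss p) s)
      (integrable_mul_signal (memLp_poly_gauss q) s)]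
    congr 1
    ext x
    simp only [Polynomial.eval_add]
    push_cast
    ring
  map_smul' c p := by
    rw [RingHom.id_apply, ← integral_smul]
    congr 1
    ext x
    simp only [Polynomial.eval_smul, smul_eq_mul, Complex.real_smul]
    push_cast
    ring

lemma polyPairing_eq_zero {s : Signal} (hs : ∀ k, inner ℂ (hermiteSignal k) s = 0) (k n : ℕ) :
    polyPairing s (Polynomial.X ^ k * hermPoly n) = 0 := by
  induction k generalizing n with
  | zero =>
    have h := hs n
    rw [inner_hermiteSignal] at h
    simp_rw [hermiteFun_eq, Complex.ofReal_mul, mul_assoc] at h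
    rw [integral_const_mul] at h
    have hp : 0 < √(√Real.pi * (2 ^ n * (n ! : ℝ))) := by positivity
    have h' := (mul_eq_zero.1 h).resolve_left (by
      refine Complex.ofReal_ne_zero.2 ?_
      exact (inv_pos.2 hp).ne')
    simpa [polyPairing, mul_assoc] using h'
  | succ k ih =>
    have hX : Polynomial.X ^ (k + 1) * hermPoly n = (1 / 2 : ℝ) • (Polynomial.X ^ k * hermPoly (n + 1))
        + (1 / 2 : ℝ) • (Polynomial.X ^ k * Polynomial.derivative (hermPoly n)) := by
      have h : hermPoly (n + 1)
        = 2 * Polynomial.X * hermPoly n - Polynomial.derivative (hermPoly n) := rfl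
      rw [← smul_add, h, Polynomial.smul_eq_C_mul]
      have h2 : Polynomial.C (1 / 2 : ℝ) * 2 = 1 := by
        rw [← Polynomial.C_ofNat, ← Polynomial.C_mul]; norm_num
      linear_combination (-(Polynomial.X ^ (k + 1) * hermPoly n)) * h2
    rw [hX, map_add, map_smul, map_smul, ih]
    cases n with
    | zero => simp [hermPoly]
    | succ n =>
      rw [hermPoly_derivative]
      have : Polynomial.X ^ k * (((2 * (n + 1) : ℕ) : Polynomial ℝ) * hermPoly n)
          = ((2 * (n + 1) : ℕ) : ℝ) • (Polynomial.X ^ k * hermPoly n) := by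
        rw [Polynomial.smul_eq_C_mul]
        simp only [Polynomial.C_eq_natCast]
        ring
      rw [this, map_smul, ih]
      simp

lemma memLp_exp_gauss (a : ℝ) :
    MemLp (fun x : ℝ => ((Real.exp (a * |x|) * Real.exp (-(1 / 2) * x ^ 2) : ℝ) : ℂ)) 2 volume := by
  refine memLp_of_sq (by fun_prop) ?_
  have hI : Integrable (fun x : ℝ => Real.exp (2 * a ^ 2) * Real.exp (-(1 / 2) * x ^ 2)) :=
    (integrable_exp_neg_mul_sq (by norm_num)).const_mul _
  refine hI.mono' (by fun_prop) (ae_of_all _ fun x => ?_)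
  rw [Real.norm_of_nonneg (by positivity), ← Real.exp_add, ← Real.exp_add, ← Real.exp_nat_mul]
  apply Real.exp_le_exp.2
  push_cast
  nlinarith [sq_nonneg (2 * a - |x|), sq_abs x]

lemma integral_cexp_eq_zero {s : Signal} (hs : ∀ k, inner ℂ (hermiteSignal k) s = 0) (c : ℂ) :
    ∫ x : ℝ, Complex.exp (c * x) * ((Real.exp (-(1 / 2) * x ^ 2) : ℝ) * s x) = 0 := by
  have h0 (k : ℕ) :
      ∫ x : ℝ, (c * x) ^ k / (k ! : ℂ) * ((Real.exp (-(1 / 2) * x ^ 2) : ℝ) * s x) = 0 := by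
    have h := polyPairing_eq_zero hs k 0
    have h' : ∫ x : ℝ, (c ^ k / (k ! : ℂ)) *
      (((x ^ k * Real.exp (-(1 / 2) * x ^ 2) : ℝ) : ℂ) * s x) = 0 := by
      rw [integral_const_mul]
      simp only [polyPairing, hermPoly, mul_one, LinearMap.coe_mk, AddHom.coe_mk,
        Polynomial.eval_pow, Polynomial.eval_X] at h
      rw [h, mul_zero]
    rw [← h']
    congr 1
    ext x
    push_cast
    ring
  have hsum := hasSum_integral_of_dominated_convergence (μ := volume)
    (F := fun (k : ℕ) (x : ℝ) =>
      (c * x) ^ k / (k ! : ℂ) * ((Real.exp (-(1 / 2) * x ^ 2) : ℝ) * s x))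
    (f := fun x : ℝ => Complex.exp (c * x) * ((Real.exp (-(1 / 2) * x ^ 2) : ℝ) * s x))
    (bound := fun (k : ℕ) (x : ℝ) =>
      (‖c‖ * |x|) ^ k / (k ! : ℝ) * ‖((Real.exp (-(1 / 2) * x ^ 2) : ℝ) : ℂ) * s x‖)
    (fun k => by
      have : AEStronglyMeasurable (fun x => s x) (volume : Measure ℝ) :=
        (Lp.memLp s).aestronglyMeasurable
      fun_prop)
    (fun k => ae_of_all _ fun x => by simp)
    (ae_of_all _ fun x => (Real.summable_pow_div_factorial _).mul_right _)
    (by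
      have h := (integrable_mul_signal (memLp_exp_gauss ‖c‖) s).norm
      refine h.congr (ae_of_all _ fun x => ?_)
      simp only
      rw [tsum_mul_right]
      have : ∑' k : ℕ, (‖c‖ * |x|) ^ k / (k ! : ℝ) = Real.exp (‖c‖ * |x|) := by
        rw [Real.exp_eq_exp_ℝ, NormedSpace.exp_eq_tsum_div]
      rw [this]
      rw [Complex.ofReal_mul, mul_assoc, norm_mul, Complex.norm_real,
        Real.norm_of_nonneg (Real.exp_pos _).le])
    (ae_of_all _ fun x => by
      refine HasSum.mul_right _ ?_
      rw [Complex.exp_eq_exp_ℂ]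
      exact NormedSpace.expSeries_div_hasSum_exp (c * x))
  simp_rw [h0] at hsum
  exact hsum.unique hasSum_zero

lemma signal_eq_zero {s : Signal} (hs : ∀ k, inner ℂ (hermiteSignal k) s = 0) : s = 0 := by
  set G : ℝ → ℂ := fun x => ((Real.exp (-(1 / 2) * x ^ 2) : ℝ) : ℂ) * s x with hG
  have hGi : Integrable G := by
    have := integrable_mul_signal (memLp_poly_gauss 1) s
    simpa [hG] using this
  have hF : FourierTransform.fourier G = 0 := by
    ext ξ
    rw [Real.fourier_eq']
    have := integral_cexp_eq_zero hs (-2 * Real.pi * ξ * Complex.I)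
    simp only [Pi.zero_apply]
    rw [← this]
    congr 1
    ext x
    simp only [smul_eq_mul, hG]
    congr 2
    simp
    ring
  have hz : ∀ᵐ x : ℝ, G x = 0 := by
    refine ae_eq_zero_of_integral_contDiff_smul_eq_zero hGi.locallyIntegrable fun g hg hgc => ?_
    have hg₁ : HasCompactSupport (Complex.ofRealCLM ∘ g) := hgc.comp_left rfl
    have hg₂ : ContDiff ℝ ((⊤ : ℕ∞) : WithTop ℕ∞) (Complex.ofRealCLM ∘ g) :=
      Complex.ofRealCLM.contDiff.comp hg
    set f₁ : SchwartzMap ℝ ℂ := hg₁.toSchwartzMap hg₂ with hf₁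
    set ψ : SchwartzMap ℝ ℂ := FourierTransformInv.fourierInv f₁ with hψ
    have h1 : FourierTransform.fourier ψ = f₁ := by simp [hψ]
    have h2 : (FourierTransform.fourier (ψ : ℝ → ℂ)) = f₁ := by
      rw [← SchwartzMap.fourier_coe, h1]
    have h3 := VectorFourier.integral_fourierIntegral_smul_eq_flip (L := innerₗ ℝ)
      Real.continuous_fourierChar continuous_inner ψ.integrable hGi (μ := volume) (ν := volume)
    have h4 : ∫ ξ : ℝ, (FourierTransform.fourier (ψ : ℝ → ℂ)) ξ • G ξ
        = ∫ x : ℝ, ψ x • FourierTransform.fourier G x := by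
      simpa [flip_innerₗ] using! h3
    rw [h2, hF] at h4
    simp only [Pi.zero_apply, smul_zero, integral_zero] at h4
    rw [← h4]
    congr 1
  rw [Lp.eq_zero_iff_ae_eq_zero]
  filter_upwards [hz] with x hx
  simpa [hG] using hx

/-- The Hilbert basis of `L²(ℝ)` formed by the Hermite functions. -/
def hermiteBasis : HilbertBasis ℕ ℂ Signal :=
  HilbertBasis.mkOfOrthogonalEqBot orthonormal_hermiteSignal (by
    rw [Submodule.eq_bot_iff]
    intro s hs
    refine signal_eq_zero fun k => ?_
    exact (Submodule.mem_orthogonal _ _).1 hs _ (Submodule.subset_span ⟨k, rfl⟩))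

lemma hermiteBasis_apply (k : ℕ) : hermiteBasis k = hermiteSignal k := by
  simp [hermiteBasis]

section WeakNorm

variable {H : Type*} [NormedAddCommGroup H] [InnerProductSpace ℂ H]

/-- A copy of the Hilbert space `H`, to carry the weak norm attached to the Hilbert basis `b`. -/
def Weakened (_b : HilbertBasis ℕ ℂ H) : Type _ := H

instance (b : HilbertBasis ℕ ℂ H) : AddCommGroup (Weakened b) := inferInstanceAs (AddCommGroup H)

instance (b : HilbertBasis ℕ ℂ H) : Module ℂ (Weakened b) := inferInstanceAs (Module ℂ H)

/-- The identity map from `H` to its copy. -/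
def toWeak (b : HilbertBasis ℕ ℂ H) : H ≃ₗ[ℂ] Weakened b := LinearEquiv.refl ℂ H

/-- The weak norm `‖s‖² = ∑ₖ |⟨s, bₖ⟩|² / (1 + k²)`. -/
instance (b : HilbertBasis ℕ ℂ H) : Norm (Weakened b) :=
  ⟨fun s => √(∑' k : ℕ, ‖inner ℂ (b k) ((toWeak b).symm s)‖ ^ 2 / (1 + (k : ℝ) ^ 2))⟩

lemma weak_norm_def (b : HilbertBasis ℕ ℂ H) (s : Weakened b) :
    ‖s‖ = √(∑' k : ℕ, ‖inner ℂ (b k) ((toWeak b).symm s)‖ ^ 2 / (1 + (k : ℝ) ^ 2)) := rfl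

lemma norm_weight_sq (c : ℂ) (k : ℕ) :
    ‖c / (√(1 + (k : ℝ) ^ 2) : ℝ)‖ ^ 2 = ‖c‖ ^ 2 / (1 + (k : ℝ) ^ 2) := by
  rw [norm_div, div_pow, Complex.norm_real, Real.norm_of_nonneg (Real.sqrt_nonneg _),
    Real.sq_sqrt (by positivity)]

lemma summable_weak (b : HilbertBasis ℕ ℂ H) (s : H) :
    Summable (fun k : ℕ => ‖inner ℂ (b k) s‖ ^ 2 / (1 + (k : ℝ) ^ 2)) := by
  have h : Summable (fun k : ℕ => ‖inner ℂ (b k) s‖ ^ 2) := b.orthonormal.inner_products_summable s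
  refine h.of_nonneg_of_le (fun k => by positivity) fun k => div_le_self (by positivity) ?_
  nlinarith [sq_nonneg (k : ℝ)]

/-- The weighted coefficient sequence of a vector (auxiliary). -/
def weakSeq (b : HilbertBasis ℕ ℂ H) (s : Weakened b) : lp (fun _ : ℕ => ℂ) 2 :=
  ⟨fun k => inner ℂ (b k) ((toWeak b).symm s) / (√(1 + (k : ℝ) ^ 2) : ℝ), by
    refine memℓp_gen ?_
    simp only [ENNReal.toReal_ofNat, Real.rpow_ofNat, norm_weight_sq]
    exact summable_weak b _⟩

lemma norm_weakSeq (b : HilbertBasis ℕ ℂ H) (s : Weakened b) : ‖weakSeq b s‖ = ‖s‖ := by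
  rw [lp.norm_eq_tsum_rpow (by norm_num), weak_norm_def, Real.sqrt_eq_rpow]
  simp only [ENNReal.toReal_ofNat, Real.rpow_ofNat, weakSeq, norm_weight_sq]

lemma weak_core (b : HilbertBasis ℕ ℂ H) : NormedSpace.Core ℂ (Weakened b) where
  norm_nonneg s := Real.sqrt_nonneg _
  norm_smul c s := by
    rw [← norm_weakSeq, ← norm_weakSeq, ← norm_smul]
    congr 1
    ext k
    simp [weakSeq, mul_div_assoc]
  norm_triangle s t := by
    rw [← norm_weakSeq, ← norm_weakSeq, ← norm_weakSeq]
    have : weakSeq b (s + t) = weakSeq b s + weakSeq b t := by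
      ext k
      simp [weakSeq, add_div]
      rfl
    rw [this]
    exact norm_add_le _ _
  norm_eq_zero_iff s := by
    rw [← norm_weakSeq, norm_eq_zero]
    constructor
    · intro h
      have hk (k : ℕ) : inner ℂ (b k) ((toWeak b).symm s) = 0 := by
        have h1 : (weakSeq b s) k = 0 := by rw [h]; rfl
        have h2 : (√(1 + (k : ℝ) ^ 2) : ℝ) ≠ 0 := by positivity
        simpa [weakSeq, h2] using! h1
      have h3 : b.repr ((toWeak b).symm s) = 0 := by
        ext k
        rw [b.repr_apply_apply, hk k]
        rfl
      exact (toWeak b).symm.map_eq_zero_iff.1 (b.repr.map_eq_zero_iff.1 h3)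
    · rintro rfl
      ext k
      simp [weakSeq]

instance (b : HilbertBasis ℕ ℂ H) : NormedAddCommGroup (Weakened b) :=
  NormedAddCommGroup.ofCore (weak_core b)

instance (b : HilbertBasis ℕ ℂ H) : NormedSpace ℂ (Weakened b) :=
  NormedSpace.ofCore (weak_core b)

/-- The completion of the Hilbert space for the weak norm: the space in which white noise lives. -/
abbrev NoiseSpace (b : HilbertBasis ℕ ℂ H) : Type _ := UniformSpace.Completion (Weakened b)

/-- The truncated white noise `∑_{k < n} aₖ bₖ` with coefficients `a`. -/
def truncatedNoise (b : HilbertBasis ℕ ℂ H) (a : ℕ → ℂ) (n : ℕ) : NoiseSpace b :=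
  (toWeak b (∑ k ∈ Finset.range n, a k • b k) : Weakened b)

/-- The sum of the series `∑ₖ aₖ bₖ` in the completed space. It is white noise associated with the
Hilbert basis `b` when the `aₖ` are i.i.d. standard complex Gaussian variables. -/
def whiteNoise (b : HilbertBasis ℕ ℂ H) (a : ℕ → ℂ) : NoiseSpace b :=
  limUnder atTop (truncatedNoise b a)

end WeakNorm

/-- The standard complex Gaussian distribution: the law of `(x + i y) / √2` for independent real
standard Gaussian variables `x` and `y`. -/
def stdComplexGaussian : Measure ℂ :=
  ((gaussianReal 0 1).prod (gaussianReal 0 1)).map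
    (fun p : ℝ × ℝ => ((p.1 : ℂ) + Complex.I * p.2) / (√2 : ℝ))

/-- `ξ` is a sequence of i.i.d. standard complex Gaussian variables. -/
structure IsStdComplexGaussianSeq {Ω : Type*} [MeasurableSpace Ω] (ξ : ℕ → Ω → ℂ)
    (P : Measure Ω) : Prop where
  hasLaw : ∀ k, HasLaw (ξ k) stdComplexGaussian P
  indep : iIndepFun ξ P

/-- The Short-Time Fourier Transform with window `h` of the signal `s`, at time `t` and angular
frequency `ω`. -/
def stft (h s : ℝ → ℂ) (t ω : ℝ) : ℂ :=
  ∫ u : ℝ, s u * conj (h (u - t)) * Complex.exp (-(Complex.I * ω * u))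

/-- The (unit energy) circular Gaussian window. -/
def gaussWindow (t : ℝ) : ℂ := (Real.pi ^ (-(1 / 4) : ℝ) * Real.exp (-t ^ 2 / 2) : ℝ)

lemma continuous_stft_gaussWindow (s : Signal) :
    Continuous (fun z : ℂ => stft gaussWindow s z.im z.re) := by
  rw [continuous_iff_continuousAt]
  intro z₀
  set M : ℝ := |z₀.im| + 1 with hM
  have hmeas : AEStronglyMeasurable (fun x => s x) (volume : Measure ℝ) :=
    (Lp.memLp s).aestronglyMeasurable
  have hw : Continuous gaussWindow := by unfold gaussWindow; fun_prop
  have hb : MemLp (fun u : ℝ => ((Real.exp (-(1 / 4) * u ^ 2) : ℝ) : ℂ)) 2 volume := by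
    refine memLp_of_sq (by fun_prop) ?_
    refine (integrable_exp_neg_mul_sq (b := 1 / 2) (by norm_num)).congr (ae_of_all _ fun u => ?_)
    simp only [sq (Real.exp _), ← Real.exp_add]
    ring_nf
  refine continuousAt_of_dominated
    (bound := fun u => (Real.pi ^ (-(1 / 4) : ℝ) * Real.exp (M ^ 2 / 2)) *
      ‖((Real.exp (-(1 / 4) * u ^ 2) : ℝ) : ℂ) * s u‖)
    (Eventually.of_forall fun z => by fun_prop) ?_
    ((integrable_mul_signal hb s).norm.const_mul _)
    (ae_of_all _ fun u => by fun_prop)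
  have hball : ∀ᶠ z : ℂ in 𝓝 z₀, |z.im| < M := by
    have : ContinuousAt (fun z : ℂ => |z.im|) z₀ := by fun_prop
    exact this.eventually_lt continuousAt_const (by simp [hM])
  filter_upwards [hball] with z hz
  refine ae_of_all _ fun u => ?_
  have hexp : ‖Complex.exp (-(Complex.I * z.re * u))‖ = 1 := by
    rw [Complex.norm_exp]; simp
  have hle : Real.exp (-(u - z.im) ^ 2 / 2)
      ≤ Real.exp (M ^ 2 / 2) * Real.exp (-(1 / 4) * u ^ 2) := by
    rw [← Real.exp_add]
    apply Real.exp_le_exp.2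
    have : z.im ^ 2 ≤ M ^ 2 := by
      rw [← sq_abs z.im]
      exact pow_le_pow_left₀ (abs_nonneg _) hz.le 2
    nlinarith [sq_nonneg (u - 2 * z.im)]
  rw [norm_mul, norm_mul, norm_mul, hexp, mul_one, RCLike.norm_conj, gaussWindow,
    Complex.norm_real, Complex.norm_real, Real.norm_of_nonneg (by positivity),
    Real.norm_of_nonneg (Real.exp_pos _).le]
  have hpi : 0 ≤ Real.pi ^ (-(1 / 4) : ℝ) := by positivity
  calc ‖s u‖ * (Real.pi ^ (-(1 / 4) : ℝ) * Real.exp (-(u - z.im) ^ 2 / 2))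
      ≤ ‖s u‖ * (Real.pi ^ (-(1 / 4) : ℝ) *
        (Real.exp (M ^ 2 / 2) * Real.exp (-(1 / 4) * u ^ 2))) := by gcongr
    _ = _ := by ring

/-- The Short-Time Fourier Transform with circular Gaussian window of a finite-energy signal, as a
continuous function of `z = ω + i t`. -/
def gaussSTFT (s : Signal) : C(ℂ, ℂ) :=
  ⟨fun z => stft gaussWindow s z.im z.re, continuous_stft_gaussWindow s⟩

/-- The extension by continuity of the Gaussian Short-Time Fourier Transform to the space in which
white noise (for the Hermite basis) lives; the space of continuous functions on `ℂ` carries the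
topology of uniform convergence on compact sets. -/
def noiseSTFT : NoiseSpace hermiteBasis → C(ℂ, ℂ) :=
  UniformSpace.Completion.extension fun s => gaussSTFT ((toWeak hermiteBasis).symm s)

/-- The Borel σ-algebra of the topology of uniform convergence on compact sets. -/
instance : MeasurableSpace C(ℂ, ℂ) := borel _

instance : BorelSpace C(ℂ, ℂ) := ⟨rfl⟩

open Classical in
/-- The power series `∑ₖ aₖ √(γᵏ / k!) zᵏ` as a continuous function on `ℂ` (by convention `0` if it
is not one). For i.i.d. standard complex Gaussian coefficients it is, almost surely, an entire
function: the planar Gaussian Analytic Function of parameter `γ`. -/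
def planarGAF (γ : ℝ) (a : ℕ → ℂ) : C(ℂ, ℂ) :=
  if h : Continuous (fun z : ℂ => ∑' k : ℕ, a k * (√(γ ^ k / (k ! : ℝ)) : ℝ) * z ^ k)
  then ⟨_, h⟩ else 0

/-- The factor `z ↦ exp(-|z|²/4 - i ω t / 2)`, with `z = ω + i t`. -/
def stftFactor : C(ℂ, ℂ) :=
  ⟨fun z => Complex.exp (-((‖z‖ ^ 2 / 4 : ℝ) : ℂ) - Complex.I * z.re * z.im / 2), by fun_prop⟩

/-- The spectrogram: the squared modulus of the Short-Time Fourier Transform. -/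
def spectrogram (F : C(ℂ, ℂ)) (z : ℂ) : ℝ := ‖F z‖ ^ 2

/-- A point configuration, encoded by its counting measure. -/
def pointCount (Z : Set ℂ) : Measure ℂ := Measure.count.restrict Z

end WhiteNoise

end

open WhiteNoise

noncomputable section

namespace WhiteNoise

/-! ### The Gaussian Short-Time Fourier Transform of the Hermite functions -/

/-! The Gaussian transform of the `k`-th Hermite function is an explicit monomial: up to the factor
`ψ`, it is `√(2⁻ᵏ/k!) (-i z)ᵏ` (`gaussSTFT_hermiteSignal`). Hence `∑ aₖ hₖ` is sent to `ψ(z) ∑ (-i)ᵏ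
aₖ √(2⁻ᵏ/k!) zᵏ`, and since the standard complex Gaussian law is invariant under multiplication by
`-i`, the variables `ζₖ = (-i)ᵏ ξₖ` are again i.i.d. standard. The identity thus holds path by path,
and equality in law follows.

All the analysis is deterministic, under the single condition `∑ |aₖ|²/(1+k²) < ∞`. The coefficients
`√(2⁻ᵏ/k!) rᵏ` decay faster than any power of `k`, so a Cauchy–Schwarz argument with weights `1+k²`
bounds the transform on compact sets by the weak norm (`norm_gaussSTFT_le`); it therefore extends to
the completion. The condition holds almost surely because the expectation of the sum is finite
(`ae_summable_of_hasLaw`).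

For the point processes, the zero configuration must be a measurable function of the random
function, up to null sets. Zeros are counted through hitting events of compact sets
(`le_encard_iff_exists_rationalBall`), and local finiteness comes from the isolated zeros of a
nonzero entire function. -/

lemma integrable_cexp_mul_poly_gauss (w : ℂ) (p : Polynomial ℝ) :
    Integrable (fun x : ℝ => Complex.exp (w * x) * ((p.eval x * Real.exp (-x ^ 2) : ℝ) : ℂ)) := by
  -- Half of the Gaussian decay is given to each factor, so that the dominating function is a
  -- product of two square-integrable ones.
  have h := ((memLp_exp_gauss |w.re|).integrable_mul (memLp_poly_gauss p)).norm
  refine h.mono' (by fun_prop) (ae_of_all _ fun x => ?_)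
  have hsplit : Real.exp (-x ^ 2) = Real.exp (-(1 / 2) * x ^ 2) * Real.exp (-(1 / 2) * x ^ 2) := by
    rw [← Real.exp_add]; ring_nf
  have hle : Real.exp (w.re * x) ≤ Real.exp (|w.re| * |x|) := by
    rw [← abs_mul]; exact Real.exp_le_exp.2 (le_abs_self _)
  have hre : (w * (x : ℂ)).re = w.re * x := by simp
  simp only [Pi.mul_apply, norm_mul, Complex.norm_exp, Complex.norm_real, Real.norm_eq_abs,
    Real.abs_exp, hsplit, hre]
  calc _ = Real.exp (w.re * x) * (|p.eval x| * (Real.exp (-(1 / 2) * x ^ 2) *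
        Real.exp (-(1 / 2) * x ^ 2))) := by ring
    _ ≤ Real.exp (|w.re| * |x|) * (|p.eval x| * (Real.exp (-(1 / 2) * x ^ 2) *
        Real.exp (-(1 / 2) * x ^ 2))) := by gcongr
    _ = _ := by ring

/-- The Laplace transform of `Hₙ(x) exp (-x²)`, `Hₙ` being the Hermite polynomials. -/
lemma integral_cexp_mul_hermPoly (w : ℂ) (n : ℕ) :
    ∫ x : ℝ, Complex.exp (w * x) * (((hermPoly n).eval x * Real.exp (-x ^ 2) : ℝ) : ℂ)
      = w ^ n * ((√Real.pi : ℝ) * Complex.exp (w ^ 2 / 4)) := by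
  induction n with
  | zero =>
    have h := integral_cexp_quadratic (b := -1) (by simp) w 0
    have e1 : ((Real.pi : ℂ) / -(-1)) ^ (1 / 2 : ℂ) = (√Real.pi : ℝ) := by
      rw [Real.sqrt_eq_rpow, Complex.ofReal_cpow Real.pi_pos.le]
      simp
    rw [e1] at h
    rw [pow_zero, one_mul, show w ^ 2 / 4 = 0 - w ^ 2 / (4 * -1) by ring, ← h]
    congr 1
    ext x
    simp only [hermPoly, Polynomial.eval_one, one_mul, Complex.ofReal_exp]
    rw [← Complex.exp_add]
    congr 1
    push_cast
    ring
  | succ n ih =>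
    have hu (x : ℝ) : HasDerivAt (fun x : ℝ => Complex.exp (w * x))
        (w * Complex.exp (w * x)) x := by
      have h1 : HasDerivAt (fun x : ℝ => w * (x : ℂ)) w x := by
        simpa using (Complex.ofRealCLM.hasDerivAt (x := x)).const_mul w
      simpa [mul_comm] using h1.cexp
    -- Since `Hₙ₊₁ exp(-x²)` is minus the derivative of `Hₙ exp(-x²)`, each integration by parts
    -- produces one factor `w`.
    have h := integral_mul_deriv_eq_deriv_mul_of_integrable
      (u := fun x : ℝ => Complex.exp (w * x)) (u' := fun x : ℝ => w * Complex.exp (w * x))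
      (v := fun x : ℝ => (((hermPoly n).eval x * Real.exp (-x ^ 2) : ℝ) : ℂ))
      (v' := fun x : ℝ => ((-((hermPoly (n + 1)).eval x * Real.exp (-x ^ 2)) : ℝ) : ℂ))
      (fun x _ => hu x) (fun x _ => (hasDerivAt_gauss (hermPoly n) x).ofReal_comp)
      (by
        refine (integrable_cexp_mul_poly_gauss w (hermPoly (n + 1))).neg.congr
          (ae_of_all _ fun x => ?_)
        simp)
      (by
        refine ((integrable_cexp_mul_poly_gauss w (hermPoly n)).const_mul w).congr
          (ae_of_all _ fun x => ?_)
        simp [mul_assoc])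
      (integrable_cexp_mul_poly_gauss w (hermPoly n))
    simp only [Complex.ofReal_neg, mul_neg, integral_neg, neg_inj, mul_assoc] at h
    rw [h, integral_const_mul, ih]
    ring

/-- The time-frequency shift of the Gaussian window, whose inner product with a signal is the
Gaussian Short-Time Fourier Transform. -/
def shiftedWindow (z : ℂ) (u : ℝ) : ℂ :=
  gaussWindow (u - z.im) * Complex.exp (Complex.I * z.re * u)

lemma memLp_shiftedWindow (z : ℂ) : MemLp (shiftedWindow z) 2 volume := by
  have hc : Continuous (shiftedWindow z) := by unfold shiftedWindow gaussWindow; fun_prop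
  rw [memLp_two_iff_integrable_sq_norm hc.aestronglyMeasurable]
  have h := ((integrable_exp_neg_mul_sq (b := 1) one_pos).comp_sub_right z.im).const_mul
    ((Real.pi ^ (-(1 / 4) : ℝ)) ^ 2)
  refine h.congr (ae_of_all _ fun u => ?_)
  have hexp : ‖Complex.exp (Complex.I * z.re * u)‖ = 1 := by rw [Complex.norm_exp]; simp
  simp only [shiftedWindow, norm_mul, hexp, mul_one, gaussWindow]
  rw [Complex.norm_real, Real.norm_of_nonneg (by positivity), mul_pow, ← Real.exp_nat_mul]
  congr 2
  push_cast
  ring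

lemma conj_gaussWindow (u : ℝ) : conj (gaussWindow u) = gaussWindow u := Complex.conj_ofReal _

lemma conj_shiftedWindow (z : ℂ) (u : ℝ) :
    conj (shiftedWindow z u)
      = conj (gaussWindow (u - z.im)) * Complex.exp (-(Complex.I * z.re * u)) := by
  rw [shiftedWindow, map_mul, ← Complex.exp_conj]
  simp

/-- Makes evaluation at `z` a continuous linear functional of the signal, which gives linearity and
lets Hermite expansions be transformed term by term. -/
lemma gaussSTFT_eq_inner (s : Signal) (z : ℂ) :
    gaussSTFT s z = inner ℂ ((memLp_shiftedWindow z).toLp _) s := by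
  rw [L2.inner_def]
  change ∫ u : ℝ, _ = _
  apply integral_congr_ae
  filter_upwards [(memLp_shiftedWindow z).coeFn_toLp] with u hu
  rw [hu, RCLike.inner_apply, conj_shiftedWindow, mul_assoc]

/-- The coefficient `√(2⁻ᵏ / k!)` of the planar Gaussian Analytic Function of parameter `1 / 2`. -/
def gafCoeff (k : ℕ) : ℝ := √((1 / 2) ^ k / (k ! : ℝ))

/-- The three factors are the normalisations of `hₖ` and of the window, and the `√π` of the Gaussian
integral; the powers of `π` cancel. -/
lemma pi_rpow_mul (k : ℕ) :
    (√(√Real.pi * 2 ^ k * (k ! : ℝ)))⁻¹ * Real.pi ^ (-(1 / 4) : ℝ) * √Real.pi = gafCoeff k := by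
  have hq : √(√Real.pi) = Real.pi ^ (1 / 4 : ℝ) := by
    rw [Real.sqrt_eq_rpow, Real.sqrt_eq_rpow, ← Real.rpow_mul Real.pi_pos.le]; norm_num
  have h2 : √Real.pi = Real.pi ^ (1 / 4 : ℝ) * Real.pi ^ (1 / 4 : ℝ) := by
    rw [Real.sqrt_eq_rpow, ← Real.rpow_add Real.pi_pos]; norm_num
  have hp : Real.pi ^ (1 / 4 : ℝ) ≠ 0 := (Real.rpow_pos_of_pos Real.pi_pos _).ne'
  rw [mul_assoc √Real.pi, Real.sqrt_mul (Real.sqrt_nonneg _), hq, Real.rpow_neg Real.pi_pos.le, h2,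
    gafCoeff, one_div 2, inv_pow, div_eq_mul_inv _ (k ! : ℝ), ← mul_inv (2 ^ k : ℝ), Real.sqrt_inv]
  field_simp

/-- Expanding the square in the window turns the transform into the Laplace transform of `Hₖ
exp(-u²)` at `w = t - iω = -i z`. The remaining exponentials `exp(-t²/2)` and `exp(w²/4)` multiply
to `ψ(z)`. -/
lemma gaussSTFT_hermiteSignal (k : ℕ) (z : ℂ) :
    gaussSTFT (hermiteSignal k) z = stftFactor z * (gafCoeff k * (-Complex.I * z) ^ k) := by
  have h1 : gaussSTFT (hermiteSignal k) z
      = ∫ u : ℝ, (hermiteFun k u : ℂ) * conj (gaussWindow (u - z.im))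
        * Complex.exp (-(Complex.I * z.re * u)) := by
    change ∫ u : ℝ, _ = _
    apply integral_congr_ae
    filter_upwards [(memLp_hermiteFun k).coeFn_toLp] with u hu
    rw [hermiteSignal, hu]
  set w : ℂ := z.im - Complex.I * z.re with hw
  have hwz : w = -Complex.I * z := by
    rw [hw]
    nth_rw 3 [← Complex.re_add_im z]
    linear_combination (z.im : ℂ) * Complex.I_sq
  set C : ℂ := (((√(√Real.pi * 2 ^ k * (k ! : ℝ)))⁻¹ * Real.pi ^ (-(1 / 4) : ℝ) : ℝ) : ℂ) with hC
  set E : ℂ := Complex.exp (-(z.im : ℂ) ^ 2 / 2) with hE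
  have h2 (u : ℝ) : (hermiteFun k u : ℂ) * conj (gaussWindow (u - z.im))
        * Complex.exp (-(Complex.I * z.re * u))
      = (C * E) *
        (Complex.exp (w * u) * (((hermPoly k).eval u * Real.exp (-u ^ 2) : ℝ) : ℂ)) := by
    have hx : Complex.exp (-(1 / 2) * u ^ 2) * Complex.exp (-(u - z.im) ^ 2 / 2)
        * Complex.exp (-(Complex.I * z.re * u))
        = E * Complex.exp (w * u) * Complex.exp (-u ^ 2) := by
      simp only [hE, hw, ← Complex.exp_add]
      congr 1
      ring
    rw [conj_gaussWindow, hermiteFun_eq, gaussWindow, hC]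
    push_cast
    linear_combination ((√(√Real.pi * 2 ^ k * (k ! : ℝ)) : ℝ) : ℂ)⁻¹
      * ((Real.pi ^ (-(1 / 4) : ℝ) : ℝ) : ℂ) * (((hermPoly k).eval u : ℝ) : ℂ) * hx
  rw [h1]
  simp_rw [h2]
  rw [integral_const_mul, integral_cexp_mul_hermPoly, ← hwz, ← pi_rpow_mul k]
  have hF : stftFactor z = E * Complex.exp (w ^ 2 / 4) := by
    change Complex.exp _ = _
    rw [hE, ← Complex.exp_add]
    congr 1
    rw [← Complex.normSq_eq_norm_sq, Complex.normSq_apply, hw]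
    push_cast
    linear_combination (-(z.re : ℂ) ^ 2 / 4) * Complex.I_sq
  rw [hF, hC]
  push_cast
  ring

lemma stftFactor_ne_zero (z : ℂ) : stftFactor z ≠ 0 := Complex.exp_ne_zero _

/-! ### Extension of the transform to the space of white noise -/

lemma gafCoeff_sq (k : ℕ) : gafCoeff k ^ 2 = (1 / 2) ^ k / (k ! : ℝ) :=
  Real.sq_sqrt (by positivity)

lemma gafCoeff_nonneg (k : ℕ) : 0 ≤ gafCoeff k := Real.sqrt_nonneg _

/-- This is the factor dual to the weak norm. As `1 + k² ≤ 2·4ᵏ`, it is dominated by an exponential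
series in `2r²`. -/
lemma summable_gafCoeff_weight (r : ℝ) :
    Summable (fun k : ℕ => (1 + (k : ℝ) ^ 2) * (gafCoeff k * r ^ k) ^ 2) := by
  refine ((Real.summable_pow_div_factorial (2 * r ^ 2)).mul_left 2).of_nonneg_of_le
    (fun k => by positivity) fun k => ?_
  have hk : (k : ℝ) ≤ 2 ^ k := by exact_mod_cast (Nat.lt_two_pow_self (n := k)).le
  have h4 : 1 + (k : ℝ) ^ 2 ≤ 2 * 4 ^ k := by
    have h1 : (1 : ℝ) ≤ 4 ^ k := one_le_pow₀ (by norm_num)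
    have h2 : (k : ℝ) ^ 2 ≤ 4 ^ k := by
      calc (k : ℝ) ^ 2 ≤ (2 ^ k) ^ 2 := by gcongr
        _ = 4 ^ k := by rw [← pow_mul, mul_comm, pow_mul]; norm_num
    linarith
  have e : 2 * ((2 * r ^ 2) ^ k / (k ! : ℝ)) = (2 * 4 ^ k) * (gafCoeff k * r ^ k) ^ 2 := by
    have : (2 * r ^ 2) ^ k = 4 ^ k * (1 / 2) ^ k * (r ^ k) ^ 2 := by
      rw [← pow_mul, mul_comm k 2, pow_mul, ← mul_pow, ← mul_pow]; norm_num
    rw [this, mul_pow, gafCoeff_sq]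
    ring
  rw [e]
  gcongr

/-- Termwise form of the weighted Cauchy–Schwarz inequality, from expanding a square. With `δ` a
bound on the weak norm, both halves sum to multiples of `δ`. -/
lemma mul_le_of_weight {x y δ : ℝ} (hδ : 0 < δ) (k : ℕ) :
    x * y ≤ (x ^ 2 / (1 + (k : ℝ) ^ 2) * δ⁻¹ + δ * ((1 + (k : ℝ) ^ 2) * y ^ 2)) / 2 := by
  have hw : 0 < 1 + (k : ℝ) ^ 2 := by positivity
  have h : 0 ≤ (x - δ * (1 + (k : ℝ) ^ 2) * y) ^ 2 / (δ * (1 + (k : ℝ) ^ 2)) := by positivity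
  have e : (x - δ * (1 + (k : ℝ) ^ 2) * y) ^ 2 / (δ * (1 + (k : ℝ) ^ 2))
      = (x ^ 2 / (1 + (k : ℝ) ^ 2) * δ⁻¹ + δ * ((1 + (k : ℝ) ^ 2) * y ^ 2)) - 2 * (x * y) := by
    field_simp
    ring
  linarith

lemma norm_gaf_term (a z : ℂ) (k : ℕ) :
    ‖a * (gafCoeff k : ℂ) * z ^ k‖ = ‖a‖ * (gafCoeff k * ‖z‖ ^ k) := by
  rw [norm_mul, norm_mul, norm_pow, Complex.norm_real, Real.norm_of_nonneg (gafCoeff_nonneg k),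
    mul_assoc]

lemma norm_stftFactor_le (z : ℂ) : ‖stftFactor z‖ ≤ 1 := by
  change ‖Complex.exp _‖ ≤ 1
  rw [Complex.norm_exp, Real.exp_le_one_iff]
  have : 0 ≤ ‖z‖ ^ 2 / 4 := by positivity
  simp only [Complex.sub_re, Complex.neg_re, Complex.ofReal_re, Complex.div_ofNat_re,
    Complex.mul_re, Complex.I_re, Complex.I_im, Complex.ofReal_im, Complex.mul_im]
  linarith

lemma hasSum_gaussSTFT (s : Signal) (z : ℂ) :
    HasSum (fun k : ℕ => stftFactor z *
      (inner ℂ (hermiteBasis k) s * (gafCoeff k : ℂ) * (-Complex.I * z) ^ k)) (gaussSTFT s z) := by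
  have h := (hermiteBasis.hasSum_repr s).mapL (innerSL ℂ ((memLp_shiftedWindow z).toLp _))
  simp only [innerSL_apply_apply, inner_smul_right, hermiteBasis.repr_apply_apply] at h
  rw [gaussSTFT_eq_inner]
  refine h.congr_fun fun k => ?_
  rw [hermiteBasis_apply, ← gaussSTFT_eq_inner, gaussSTFT_hermiteSignal]
  ring

/-- A positive upper bound `δ` replaces the weak norm itself, which may vanish while the argument
divides by it. -/
lemma norm_gaussSTFT_le {s : Signal} {δ R : ℝ} (hδ : 0 < δ) {z : ℂ} (hz : ‖z‖ ≤ R)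
    (hs : ‖toWeak hermiteBasis s‖ ≤ δ) :
    ‖gaussSTFT s z‖ ≤ δ * (1 + ∑' k : ℕ, (1 + (k : ℝ) ^ 2) * (gafCoeff k * R ^ k) ^ 2) := by
  set M := ∑' k : ℕ, (1 + (k : ℝ) ^ 2) * (gafCoeff k * R ^ k) ^ 2 with hM
  have hM0 : 0 ≤ M := tsum_nonneg fun k => by positivity
  have h1 : ∑' k : ℕ, ‖inner ℂ (hermiteBasis k) s‖ ^ 2 / (1 + (k : ℝ) ^ 2) ≤ δ ^ 2 := by
    rw [weak_norm_def, Real.sqrt_le_left hδ.le] at hs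
    exact hs
  have hsum := (((summable_weak hermiteBasis s).hasSum.mul_right δ⁻¹).add
    ((summable_gafCoeff_weight R).hasSum.mul_left δ)).div_const 2
  have h2 : ‖gaussSTFT s z‖ ≤ ((∑' k : ℕ, ‖inner ℂ (hermiteBasis k) s‖ ^ 2 / (1 + (k : ℝ) ^ 2))
      * δ⁻¹ + δ * M) / 2 := by
    rw [← (hasSum_gaussSTFT s z).tsum_eq]
    refine tsum_of_norm_bounded hsum fun k => ?_
    refine le_trans ?_ (mul_le_of_weight (y := gafCoeff k * R ^ k) hδ k)
    rw [norm_mul, norm_gaf_term, norm_mul, norm_neg, Complex.norm_I, one_mul]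
    have := norm_stftFactor_le z
    have hc := gafCoeff_nonneg k
    calc _ ≤ 1 * (‖inner ℂ (hermiteBasis k) s‖ * (gafCoeff k * R ^ k)) := by gcongr
      _ = _ := one_mul _
  refine h2.trans ?_
  have h3 : (∑' k : ℕ, ‖inner ℂ (hermiteBasis k) s‖ ^ 2 / (1 + (k : ℝ) ^ 2)) * δ⁻¹ ≤ δ := by
    calc _ ≤ δ ^ 2 * δ⁻¹ := by gcongr
      _ = δ := by field_simp
  have h4 : 0 ≤ δ * M := by positivity
  linarith

lemma gaussSTFT_sub (s t : Signal) (z : ℂ) :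
    gaussSTFT (s - t) z = gaussSTFT s z - gaussSTFT t z := by
  simp only [gaussSTFT_eq_inner, inner_sub_right]

lemma uniformContinuous_gaussSTFT :
    UniformContinuous
      (fun s : Weakened hermiteBasis => gaussSTFT ((toWeak hermiteBasis).symm s)) := by
  rw [Metric.uniformity_basis_dist.uniformContinuous_iff
    ContinuousMap.hasBasis_compactConvergenceUniformity]
  rintro ⟨K, V⟩ ⟨hK, hV⟩
  obtain ⟨ε, hε, hεV⟩ := Metric.mem_uniformity_dist.1 hV
  obtain ⟨R, hR⟩ := hK.isBounded.exists_norm_le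
  set M := ∑' k : ℕ, (1 + (k : ℝ) ^ 2) * (gafCoeff k * R ^ k) ^ 2 with hM
  have hM0 : 0 ≤ M := tsum_nonneg fun k => by positivity
  -- By linearity only the transform of `s - t` matters; this choice bounds it by `ε / 2` on `K`.
  refine ⟨ε / (2 * (1 + M)), by positivity, fun s t hst z hz => hεV ?_⟩
  rw [Set.mem_ofPred_eq, dist_eq_norm] at hst
  change dist (gaussSTFT _ z) (gaussSTFT _ z) < ε
  rw [dist_eq_norm, ← gaussSTFT_sub, ← map_sub]
  refine (norm_gaussSTFT_le (δ := ε / (2 * (1 + M))) (by positivity) (hR z hz)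
    (by simpa using hst.le)).trans_lt ?_
  rw [← hM]
  have : ε / (2 * (1 + M)) * (1 + M) = ε / 2 := by field_simp
  linarith

/-- `Completion.extension` is continuous whatever the map; uniform continuity is needed for it to
extend `gaussSTFT`, in `noiseSTFT_toWeak`. -/
lemma continuous_noiseSTFT : Continuous noiseSTFT :=
  UniformSpace.Completion.continuous_extension

lemma noiseSTFT_toWeak (s : Signal) :
    noiseSTFT (toWeak hermiteBasis s : Weakened hermiteBasis) = gaussSTFT s :=
  (UniformSpace.Completion.extension_coe uniformContinuous_gaussSTFT _).trans (by simp)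

/-! ### Convergence of white noise -/

section WeakNorm

variable {H : Type*} [NormedAddCommGroup H] [InnerProductSpace ℂ H]

lemma inner_basis_sum (b : HilbertBasis ℕ ℂ H) (a : ℕ → ℂ) (F : Finset ℕ) (k : ℕ) :
    inner ℂ (b k) (∑ j ∈ F, a j • b j) = if k ∈ F then a k else 0 := by
  simp [orthonormal_iff_ite.1 b.orthonormal]

lemma norm_toWeak_sum_sq (b : HilbertBasis ℕ ℂ H) (a : ℕ → ℂ) (F : Finset ℕ) :
    ‖toWeak b (∑ k ∈ F, a k • b k)‖ ^ 2 = ∑ k ∈ F, ‖a k‖ ^ 2 / (1 + (k : ℝ) ^ 2) := by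
  rw [weak_norm_def, Real.sq_sqrt (tsum_nonneg fun k => by positivity)]
  simp only [LinearEquiv.symm_apply_apply, inner_basis_sum]
  rw [tsum_eq_sum (s := F) (fun k hk => by simp [hk])]
  exact Finset.sum_congr rfl fun k hk => by rw [if_pos hk]

/-- By orthonormality the squared weak norm of a block of the series is the corresponding block of
`ha`, so the partial sums are Cauchy and the `limUnder` in `whiteNoise` is a genuine limit. -/
lemma tendsto_truncatedNoise (b : HilbertBasis ℕ ℂ H) {a : ℕ → ℂ}
    (ha : Summable (fun k : ℕ => ‖a k‖ ^ 2 / (1 + (k : ℝ) ^ 2))) :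
    Tendsto (truncatedNoise b a) atTop (𝓝 (whiteNoise b a)) := by
  refine CauchySeq.tendsto_limUnder ?_
  rw [Metric.cauchySeq_iff']
  intro ε hε
  obtain ⟨N, hN⟩ := Metric.cauchySeq_iff'.1 ha.hasSum.tendsto_sum_nat.cauchySeq (ε ^ 2)
    (by positivity)
  refine ⟨N, fun n hn => ?_⟩
  have h := hN n hn
  rw [dist_eq_norm, Finset.sum_range_sub_sum_range hn, Real.norm_eq_abs] at h
  rw [truncatedNoise, truncatedNoise, UniformSpace.Completion.dist_eq, dist_eq_norm, ← map_sub,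
    Finset.sum_range_sub_sum_range hn]
  refine lt_of_pow_lt_pow_left₀ 2 hε.le ?_
  rw [norm_toWeak_sum_sq]
  exact (le_abs_self _).trans_lt h

end WeakNorm

/-! ### The planar Gaussian Analytic Function -/

/-- The partial sums of the series defining the planar Gaussian Analytic Function of
parameter `1 / 2`. -/
def gafPartialSum (a : ℕ → ℂ) (n : ℕ) : C(ℂ, ℂ) :=
  ⟨fun z => ∑ k ∈ Finset.range n, a k * (gafCoeff k : ℂ) * z ^ k, by fun_prop⟩

lemma summable_gaf {a : ℕ → ℂ} (ha : Summable (fun k : ℕ => ‖a k‖ ^ 2 / (1 + (k : ℝ) ^ 2)))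
    (z : ℂ) : Summable (fun k : ℕ => a k * (gafCoeff k : ℂ) * z ^ k) := by
  refine Summable.of_norm_bounded (((ha.mul_right 1⁻¹).add
    ((summable_gafCoeff_weight ‖z‖).mul_left 1)).div_const 2) fun k => ?_
  rw [norm_gaf_term]
  exact mul_le_of_weight one_pos k

lemma noiseSTFT_truncatedNoise (a : ℕ → ℂ) (n : ℕ) :
    noiseSTFT (truncatedNoise hermiteBasis a n)
      = stftFactor * gafPartialSum (fun k => (-Complex.I) ^ k * a k) n := by
  rw [truncatedNoise, noiseSTFT_toWeak]
  ext z
  rw [gaussSTFT_eq_inner, inner_sum, ContinuousMap.mul_apply]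
  change _ = _ * ∑ k ∈ Finset.range n, _
  rw [Finset.mul_sum]
  refine Finset.sum_congr rfl fun k _ => ?_
  rw [inner_smul_right, hermiteBasis_apply, ← gaussSTFT_eq_inner, gaussSTFT_hermiteSignal]
  ring

lemma norm_neg_I_pow_mul (a : ℂ) (k : ℕ) : ‖(-Complex.I) ^ k * a‖ = ‖a‖ := by simp

lemma I_pow_mul_neg_I_pow (k : ℕ) : (-Complex.I) ^ k * Complex.I ^ k = 1 := by
  rw [← mul_pow]; simp

/-- The inverse of the nowhere vanishing function `stftFactor`. -/
def stftFactorInv : C(ℂ, ℂ) :=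
  ⟨fun z => (stftFactor z)⁻¹, stftFactor.continuous.inv₀ stftFactor_ne_zero⟩

lemma stftFactorInv_mul (f : C(ℂ, ℂ)) : stftFactorInv * (stftFactor * f) = f := by
  ext z
  change (stftFactor z)⁻¹ * (stftFactor z * f z) = f z
  rw [inv_mul_cancel_left₀ (stftFactor_ne_zero z)]

/-- Locally uniform convergence of the power series is inherited from that of the white noise
series: apply the continuous transform, then divide by `ψ`. -/
lemma tendsto_gafPartialSum_aux {a : ℕ → ℂ}
    (ha : Summable (fun k : ℕ => ‖a k‖ ^ 2 / (1 + (k : ℝ) ^ 2))) :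
    Tendsto (gafPartialSum (fun k => (-Complex.I) ^ k * a k)) atTop
      (𝓝 (stftFactorInv * noiseSTFT (whiteNoise hermiteBasis a))) := by
  have h := ((continuous_noiseSTFT.tendsto _).comp
    (tendsto_truncatedNoise hermiteBasis ha)).const_mul stftFactorInv
  refine h.congr fun n => ?_
  rw [Function.comp_apply, noiseSTFT_truncatedNoise, stftFactorInv_mul]

/-- A limit in `C(ℂ, ℂ)` has the pointwise sum as its values, which supplies the continuity that
rules out the default value `0` of `planarGAF`. -/
lemma planarGAF_eq_of_tendsto {a : ℕ → ℂ} {F : C(ℂ, ℂ)}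
    (ha : Summable (fun k : ℕ => ‖a k‖ ^ 2 / (1 + (k : ℝ) ^ 2)))
    (h : Tendsto (gafPartialSum a) atTop (𝓝 F)) : planarGAF (1 / 2) a = F := by
  have hF (z : ℂ) : ∑' k : ℕ, a k * (√((1 / 2) ^ k / (k ! : ℝ)) : ℝ) * z ^ k = F z := by
    have h1 : Tendsto (fun n => gafPartialSum a n z) atTop (𝓝 (F z)) :=
      ((continuous_eval_const z).tendsto F).comp h
    exact tendsto_nhds_unique (summable_gaf ha z).hasSum.tendsto_sum_nat h1
  have hc : Continuous (fun z : ℂ => ∑' k : ℕ, a k * (√((1 / 2) ^ k / (k ! : ℝ)) : ℝ) * z ^ k) := by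
    rw [funext hF]; exact F.continuous
  rw [planarGAF, dif_pos hc]
  ext z
  exact hF z

/-- The Short-Time Fourier Transform of white noise is, up to a nowhere vanishing factor, the
planar Gaussian Analytic Function with rotated coefficients. -/
lemma noiseSTFT_whiteNoise {a : ℕ → ℂ}
    (ha : Summable (fun k : ℕ => ‖a k‖ ^ 2 / (1 + (k : ℝ) ^ 2))) :
    noiseSTFT (whiteNoise hermiteBasis a)
      = stftFactor * planarGAF (1 / 2) (fun k => (-Complex.I) ^ k * a k) := by
  rw [planarGAF_eq_of_tendsto (by simpa only [norm_neg_I_pow_mul] using ha)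
    (tendsto_gafPartialSum_aux ha)]
  ext z
  change _ = stftFactor z * ((stftFactor z)⁻¹ * _)
  rw [mul_inv_cancel_left₀ (stftFactor_ne_zero z)]

lemma tendsto_gafPartialSum {a : ℕ → ℂ}
    (ha : Summable (fun k : ℕ => ‖a k‖ ^ 2 / (1 + (k : ℝ) ^ 2))) :
    Tendsto (gafPartialSum a) atTop (𝓝 (planarGAF (1 / 2) a)) := by
  -- Coefficients are rotated by `iᵏ` beforehand to undo the rotation by `(-i)ᵏ`.
  have h := tendsto_gafPartialSum_aux (a := fun k => Complex.I ^ k * a k) (by simpa using ha)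
  have e : (fun k => (-Complex.I) ^ k * (Complex.I ^ k * a k)) = a := by
    ext k; rw [← mul_assoc, I_pow_mul_neg_I_pow, one_mul]
  rw [e] at h
  rwa [planarGAF_eq_of_tendsto ha h]

lemma hasSum_planarGAF {a : ℕ → ℂ}
    (ha : Summable (fun k : ℕ => ‖a k‖ ^ 2 / (1 + (k : ℝ) ^ 2))) (z : ℂ) :
    HasSum (fun k : ℕ => a k * (√((1 / 2) ^ k / (k ! : ℝ)) : ℝ) * z ^ k)
      (planarGAF (1 / 2) a z) := by
  have h1 : Tendsto (fun n => gafPartialSum a n z) atTop (𝓝 (planarGAF (1 / 2) a z)) :=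
    ((continuous_eval_const z).tendsto _).comp (tendsto_gafPartialSum ha)
  have h2 := (summable_gaf ha z).hasSum
  rwa [tendsto_nhds_unique h2.tendsto_sum_nat h1] at h2

lemma differentiable_planarGAF {a : ℕ → ℂ}
    (ha : Summable (fun k : ℕ => ‖a k‖ ^ 2 / (1 + (k : ℝ) ^ 2))) :
    Differentiable ℂ (planarGAF (1 / 2) a) := by
  have h := ContinuousMap.tendsto_iff_tendstoLocallyUniformly.1 (tendsto_gafPartialSum ha)
  rw [← differentiableOn_univ]
  refine (tendstoLocallyUniformlyOn_univ.2 h).differentiableOn (Eventually.of_forall fun n => ?_)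
    isOpen_univ
  change DifferentiableOn ℂ (fun z => ∑ k ∈ Finset.range n, a k * (gafCoeff k : ℂ) * z ^ k) _
  fun_prop

lemma planarGAF_zero_apply {a : ℕ → ℂ}
    (ha : Summable (fun k : ℕ => ‖a k‖ ^ 2 / (1 + (k : ℝ) ^ 2))) :
    planarGAF (1 / 2) a 0 = a 0 := by
  rw [← (hasSum_planarGAF ha 0).tsum_eq, tsum_eq_single 0 (fun k hk => by simp [hk])]
  simp

/-! ### Sequences of standard complex Gaussian variables -/

lemma measurePreserving_stdComplexGaussian :
    MeasurePreserving (fun p : ℝ × ℝ => ((p.1 : ℂ) + Complex.I * p.2) / (√2 : ℝ))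
      ((gaussianReal 0 1).prod (gaussianReal 0 1)) stdComplexGaussian :=
  ⟨by fun_prop, rfl⟩

instance : IsProbabilityMeasure stdComplexGaussian :=
  Measure.isProbabilityMeasure_map measurePreserving_stdComplexGaussian.measurable.aemeasurable

/-- Multiplication by `-i` sends `(x, y)` to `(y, -x)`: a swap, then a sign change, both preserving
the product of centred Gaussians. -/
lemma measurePreserving_neg_I_mul :
    MeasurePreserving (fun z : ℂ => -Complex.I * z) stdComplexGaussian stdComplexGaussian := by
  have hneg : MeasurePreserving (fun x : ℝ => -x) (gaussianReal 0 1) (gaussianReal 0 1) :=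
    ⟨by fun_prop, by rw [gaussianReal_map_neg, neg_zero]⟩
  have hrot := ((MeasurePreserving.id (gaussianReal 0 1)).prod hneg).comp
    (Measure.measurePreserving_swap (μ := gaussianReal 0 1) (ν := gaussianReal 0 1))
  have h := measurePreserving_stdComplexGaussian.comp hrot
  refine ⟨by fun_prop, ?_⟩
  nth_rw 1 [stdComplexGaussian]
  rw [Measure.map_map (by fun_prop) (by fun_prop), ← h.map_eq]
  congr 1
  ext p
  simp only [Function.comp_apply, Prod.map, Prod.swap, id]
  push_cast
  linear_combination (-(p.2 : ℂ) / (√2 : ℝ)) * Complex.I_sq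

lemma measurePreserving_neg_I_pow_mul (k : ℕ) :
    MeasurePreserving (fun z : ℂ => (-Complex.I) ^ k * z) stdComplexGaussian
      stdComplexGaussian := by
  have h := measurePreserving_neg_I_mul.iterate k
  rwa [mul_left_iterate] at h

lemma integrable_norm_sq_stdComplexGaussian :
    Integrable (fun z : ℂ => ‖z‖ ^ 2) stdComplexGaussian := by
  have hsq : Integrable (fun x : ℝ => x ^ 2) (gaussianReal 0 1) :=
    (memLp_id_gaussianReal' 2 (by simp)).integrable_sq
  rw [stdComplexGaussian, integrable_map_measure (by fun_prop) (by fun_prop)]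
  refine (((hsq.comp_fst (gaussianReal 0 1)).add (hsq.comp_snd (gaussianReal 0 1))).div_const
    2).congr (ae_of_all _ fun p => ?_)
  simp only [Function.comp_apply, Pi.add_apply]
  rw [norm_div, div_pow, Complex.norm_real, Real.norm_of_nonneg (Real.sqrt_nonneg _),
    Real.sq_sqrt (by norm_num), ← Complex.normSq_eq_norm_sq, Complex.normSq_apply]
  simp
  ring

lemma ae_ne_zero_stdComplexGaussian : ∀ᵐ z ∂stdComplexGaussian, z ≠ 0 := by
  rw [stdComplexGaussian, ae_map_iff (p := fun z : ℂ => z ≠ 0) (by fun_prop) (measurableSet_singleton 0).compl]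
  have := nullSingletonClass_gaussianReal (μ := 0) (v := 1) (by simp)
  have h : ∀ᵐ x ∂gaussianReal 0 1, x ≠ 0 := by simp [ae_iff]
  have h' := Measure.quasiMeasurePreserving_fst (μ := gaussianReal 0 1) (ν := gaussianReal 0 1)
    |>.ae h
  filter_upwards [h'] with p hp h0
  have hs : ((√2 : ℝ) : ℂ) ≠ 0 := Complex.ofReal_ne_zero.2 (by positivity)
  have h1 := congrArg Complex.re ((div_eq_zero_iff.1 h0).resolve_right hs)
  exact hp (by simpa using h1)

section Sequences

variable {Ω : Type*} [MeasurableSpace Ω] {P : Measure Ω} {ξ : ℕ → Ω → ℂ}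

/-- The second moments are finite and do not depend on `k`, and `∑ 1/(1+k²)` converges, so the `L¹`
norms of the terms are summable. -/
lemma ae_summable_of_hasLaw (hξ : ∀ k, HasLaw (ξ k) stdComplexGaussian P) :
    ∀ᵐ x ∂P, Summable (fun k : ℕ => ‖ξ k x‖ ^ 2 / (1 + (k : ℝ) ^ 2)) := by
  have hmeas (k : ℕ) : AEMeasurable (ξ k) P := (hξ k).aemeasurable
  have hnorm (k : ℕ) : eLpNorm (fun x => ‖ξ k x‖ ^ 2 / (1 + (k : ℝ) ^ 2)) 1 P
      = ‖(1 : ℝ) / (1 + (k : ℝ) ^ 2)‖ₑ * eLpNorm (fun z : ℂ => ‖z‖ ^ 2) 1 stdComplexGaussian := by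
    rw [← eLpNorm_const_smul, ← (hξ k).map_eq,
      eLpNorm_map_measure (by fun_prop) (hmeas k)]
    congr 1
    ext x
    simp
    ring
  have hs : Summable (fun k : ℕ => ‖(1 : ℝ) / (1 + (k : ℝ) ^ 2)‖) := by
    refine ((Real.summable_one_div_nat_pow (p := 2)).2 one_lt_two).of_norm_bounded_eventually_nat ?_
    filter_upwards [eventually_gt_atTop 0] with k hk
    rw [norm_norm, Real.norm_of_nonneg (by positivity)]
    have : (0 : ℝ) < k := by exact_mod_cast hk
    gcongr
    linarith
  have h := summable_norm_of_tsum_eLpNorm_ne_top (μ := P) (p := 1) le_rfl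
    (f := fun k x => ‖ξ k x‖ ^ 2 / (1 + (k : ℝ) ^ 2))
    (fun k => AEMeasurable.aestronglyMeasurable (by fun_prop)) (by
      simp_rw [hnorm]
      rw [ENNReal.tsum_mul_right]
      refine ENNReal.mul_ne_top (tsum_enorm_ne_top_iff_summable_norm.2 hs) ?_
      exact (memLp_one_iff_integrable.2 integrable_norm_sq_stdComplexGaussian).eLpNorm_ne_top)
  filter_upwards [h] with x hx
  exact hx.of_norm

lemma IsStdComplexGaussianSeq.rotate (hξ : IsStdComplexGaussianSeq ξ P) :
    IsStdComplexGaussianSeq (fun k x => (-Complex.I) ^ k * ξ k x) P where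
  hasLaw k := (measurePreserving_neg_I_pow_mul k).fun_comp_hasLaw (hξ.hasLaw k)
  indep := hξ.indep.comp (fun k z => (-Complex.I) ^ k * z) fun k => by fun_prop

lemma IsStdComplexGaussianSeq.map_eq (hξ : IsStdComplexGaussianSeq ξ P) :
    P.map (fun x k => ξ k x) = Measure.infinitePi fun _ : ℕ => stdComplexGaussian := by
  rw [hξ.indep.map_fun_eq_infinitePi_map₀' fun k => (hξ.hasLaw k).aemeasurable]
  congr 1
  ext1 k
  exact (hξ.hasLaw k).map_eq

lemma continuous_gafPartialSum (n : ℕ) : Continuous (fun a => gafPartialSum a n) := by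
  refine ContinuousMap.continuous_of_continuous_uncurry _ ?_
  change Continuous fun p : (ℕ → ℂ) × ℂ =>
    ∑ k ∈ Finset.range n, p.1 k * (gafCoeff k : ℂ) * p.2 ^ k
  fun_prop

/-- Almost everywhere limit of maps continuous in the coefficients; outside the summability event
nothing is claimed about `planarGAF`. -/
lemma aemeasurable_planarGAF :
    AEMeasurable (planarGAF (1 / 2)) (Measure.infinitePi fun _ : ℕ => stdComplexGaussian) := by
  refine aemeasurable_of_tendsto_metrizable_ae atTop
    (fun n => (continuous_gafPartialSum n).measurable.aemeasurable) ?_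
  have h := ae_summable_of_hasLaw (P := Measure.infinitePi fun _ : ℕ => stdComplexGaussian)
    (ξ := fun k a => a k) fun k =>
      (measurePreserving_eval_infinitePi (fun _ : ℕ => stdComplexGaussian) k).hasLaw
  filter_upwards [h] with a ha
  exact tendsto_gafPartialSum ha

/-- All planar Gaussian Analytic Functions of parameter `1 / 2` have the same law. -/
lemma identDistrib_planarGAF {Ω' : Type*} [MeasurableSpace Ω'] {P' : Measure Ω'}
    {η : ℕ → Ω' → ℂ} (hξ : IsStdComplexGaussianSeq ξ P) (hη : IsStdComplexGaussianSeq η P') :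
    IdentDistrib (fun x => planarGAF (1 / 2) (fun k => ξ k x))
      (fun y => planarGAF (1 / 2) (fun k => η k y)) P P' := by
  have h : IdentDistrib (fun x k => ξ k x) (fun y k => η k y) P P' :=
    ⟨aemeasurable_pi_iff.2 fun k => (hξ.hasLaw k).aemeasurable,
      aemeasurable_pi_iff.2 fun k => (hη.hasLaw k).aemeasurable, by rw [hξ.map_eq, hη.map_eq]⟩
  exact h.comp_of_aemeasurable (by rw [hξ.map_eq]; exact aemeasurable_planarGAF)

/-- The value at `0` is `ξ₀`, whose law has no atom at `0`. This excludes the zero function. -/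
lemma IsStdComplexGaussianSeq.ae_planarGAF_ne_zero (hξ : IsStdComplexGaussianSeq ξ P) :
    ∀ᵐ x ∂P, planarGAF (1 / 2) (fun k => ξ k x) 0 ≠ 0 := by
  have h0 : ∀ᵐ x ∂P, ξ 0 x ≠ 0 := by
    have h := ae_ne_zero_stdComplexGaussian
    rw [← (hξ.hasLaw 0).map_eq] at h
    exact ae_of_ae_map (hξ.hasLaw 0).aemeasurable h
  filter_upwards [ae_summable_of_hasLaw hξ.hasLaw, h0] with x hx hx0
  rwa [planarGAF_zero_apply hx]

end Sequences

/-! ### The zeros of a continuous function as a point configuration -/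

/-- Having no zero in `K` means mapping `K` into the open set `{0}ᶜ`, an open condition in the
compact-open topology. -/
lemma measurableSet_inter_zeros_nonempty {K : Set ℂ} (hK : IsCompact K) :
    MeasurableSet {f : C(ℂ, ℂ) | ({z | f z = 0} ∩ K).Nonempty} := by
  have h := (ContinuousMap.isOpen_setOfPred_mapsTo (X := ℂ) (Y := ℂ) hK
    (isOpen_compl_singleton (x := 0))).measurableSet.compl
  convert! h using 1
  ext f
  simp [Set.MapsTo, Set.Nonempty, and_comm]

/-- A countable family of closed balls containing arbitrarily small neighbourhoods of each point. -/
def rationalBall (i : ℕ × ℕ) : Set ℂ :=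
  Metric.closedBall (TopologicalSpace.denseSeq ℂ i.1) (1 / ((i.2 : ℝ) + 1))

lemma exists_rationalBall_subset {U : Set ℂ} (hU : IsOpen U) {z : ℂ} (hz : z ∈ U) :
    ∃ i, z ∈ rationalBall i ∧ rationalBall i ⊆ U := by
  obtain ⟨ε, hε, hεU⟩ := Metric.isOpen_iff.1 hU z hz
  obtain ⟨m, hm⟩ := exists_nat_one_div_lt (half_pos hε)
  obtain ⟨j, hj⟩ := (TopologicalSpace.denseRange_denseSeq ℂ).exists_dist_lt z
    (show (0 : ℝ) < 1 / ((m : ℝ) + 1) by positivity)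
  refine ⟨(j, m), Metric.mem_closedBall.2 hj.le, fun y hy => hεU ?_⟩
  have hy' := Metric.mem_closedBall.1 hy
  rw [dist_comm] at hj
  have := dist_triangle y (TopologicalSpace.denseSeq ℂ j) z
  simp only at hy'
  exact Metric.mem_ball.2 (by linarith)

/-- Distinct points are separated by disjoint balls of a countable family, so a lower bound on
cardinality becomes a countable union of finite intersections of hitting events. -/
lemma le_encard_iff_exists_rationalBall (Z : Set ℂ) (n : ℕ) :
    (n : ℕ∞) ≤ Z.encard ↔ ∃ T : Finset (ℕ × ℕ), (T.card = n ∧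
      (T : Set (ℕ × ℕ)).PairwiseDisjoint rationalBall) ∧
      ∀ i ∈ T, (Z ∩ rationalBall i).Nonempty := by
  constructor
  · intro h
    obtain ⟨t, htZ, htn⟩ := Set.exists_subset_encard_eq h
    have htf : t.Finite := Set.finite_of_encard_eq_coe htn
    obtain ⟨U, hU, hdisj⟩ := htf.t2_separation
    choose i hi hiU using fun z => exists_rationalBall_subset (hU z).2 (hU z).1
    have hpd : ∀ x ∈ t, ∀ y ∈ t, x ≠ y → Disjoint (rationalBall (i x)) (rationalBall (i y)) :=
      fun x hx y hy hxy => (hdisj hx hy hxy).mono (hiU x) (hiU y)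
    have hinj : Set.InjOn i t := by
      intro x hx y hy hxy
      by_contra hne
      have := hpd x hx y hy hne
      rw [hxy, disjoint_self] at this
      exact (this ▸ hi y : y ∈ (⊥ : Set ℂ))
    refine ⟨htf.toFinset.image i, ⟨?_, ?_⟩, ?_⟩
    · rw [Finset.card_image_of_injOn (by simpa using hinj)]
      rw [htf.encard_eq_coe_toFinset_card] at htn
      exact_mod_cast htn
    · intro a ha b hb hab
      simp only [Finset.coe_image, Set.Finite.coe_toFinset, Set.mem_image] at ha hb
      obtain ⟨x, hx, rfl⟩ := ha
      obtain ⟨y, hy, rfl⟩ := hb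
      exact hpd x hx y hy fun e => hab (by rw [e])
    · intro a ha
      simp only [Finset.mem_image, Set.Finite.mem_toFinset] at ha
      obtain ⟨x, hx, rfl⟩ := ha
      exact ⟨x, htZ hx, hi x⟩
  · rintro ⟨T, ⟨rfl, hT⟩, hne⟩
    choose! p hp using hne
    rw [← Set.encard_coe_eq_coe_finsetCard]
    refine Set.encard_le_encard_of_injOn (f := p) (fun i hi => (hp i hi).1) fun i hi j hj hij => ?_
    by_contra hne
    exact Set.disjoint_left.1 (hT hi hj hne) (hp i hi).2 (hij ▸ (hp j hj).2)

lemma measurable_count_zeros {K : Set ℂ} (hK : IsCompact K) :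
    Measurable (fun f : C(ℂ, ℂ) => Measure.count ({z | f z = 0} ∩ K)) := by
  have hle (n : ℕ) : MeasurableSet {f : C(ℂ, ℂ) | (n : ℕ∞) ≤ ({z | f z = 0} ∩ K).encard} := by
    have he : {f : C(ℂ, ℂ) | (n : ℕ∞) ≤ ({z | f z = 0} ∩ K).encard}
        = ⋃ T ∈ {T : Finset (ℕ × ℕ) | T.card = n ∧
            (T : Set (ℕ × ℕ)).PairwiseDisjoint rationalBall},
          ⋂ i ∈ T, {f : C(ℂ, ℂ) | ({z | f z = 0} ∩ (K ∩ rationalBall i)).Nonempty} := by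
      ext f
      simp only [Set.mem_ofPred_eq, le_encard_iff_exists_rationalBall, Set.mem_iUnion,
        Set.mem_iInter, exists_prop, Set.inter_assoc]
    rw [he]
    refine MeasurableSet.biUnion (Set.to_countable _) fun T _ =>
      Finset.measurableSet_biInter _ fun i _ => ?_
    exact measurableSet_inter_zeros_nonempty (hK.inter_right Metric.isClosed_closedBall)
  have henc : Measurable (fun f : C(ℂ, ℂ) => ({z | f z = 0} ∩ K).encard) := by
    refine ENat.measurable_iff.2 fun n => ?_
    convert! (hle n).diff (hle (n + 1)) using 1
    ext f
    simp only [Set.mem_preimage, Set.mem_singleton_iff, Set.mem_sdiff, Set.mem_ofPred_eq, not_le]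
    push_cast
    rw [ENat.lt_add_one_iff (ENat.natCast_ne_top n)]
    exact ⟨fun h => ⟨h.ge, h.le⟩, fun h => le_antisymm h.2 h.1⟩
  have hcount (f : C(ℂ, ℂ)) : Measure.count ({z | f z = 0} ∩ K)
      = (({z | f z = 0} ∩ K).encard : ENNReal) :=
    Measure.count_apply ((isClosed_eq f.continuous continuous_const).measurableSet.inter
      hK.measurableSet)
  simp_rw [hcount]
  fun_prop

/-- The continuous functions whose zeros are locally finite. -/
def locallyFiniteZeros : Set C(ℂ, ℂ) :=
  {f | ∀ N : ℕ, Measure.count ({z | f z = 0} ∩ Metric.closedBall 0 (N : ℝ)) < ⊤}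

lemma measurableSet_locallyFiniteZeros : MeasurableSet locallyFiniteZeros := by
  have : locallyFiniteZeros = ⋂ N : ℕ, {f : C(ℂ, ℂ) |
      Measure.count ({z | f z = 0} ∩ Metric.closedBall 0 (N : ℝ)) < ⊤} := by
    ext f; simp [locallyFiniteZeros]
  rw [this]
  exact MeasurableSet.iInter fun N =>
    measurableSet_lt (measurable_count_zeros (isCompact_closedBall 0 _)) measurable_const

open Classical in
/-- The counting measure of the zeros of a continuous function, if they are locally finite. -/
def zeroCount (f : C(ℂ, ℂ)) : Measure ℂ :=
  if f ∈ locallyFiniteZeros then pointCount {z | f z = 0} else 0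

lemma zeroCount_apply (f : C(ℂ, ℂ)) {s : Set ℂ} (hs : MeasurableSet s) :
    zeroCount f s
      = locallyFiniteZeros.indicator (fun f => Measure.count ({z | f z = 0} ∩ s)) f := by
  by_cases hf : f ∈ locallyFiniteZeros
  · rw [zeroCount, if_pos hf, Set.indicator_of_mem hf, pointCount, Measure.restrict_apply hs,
      Set.inter_comm]
  · rw [zeroCount, if_neg hf, Set.indicator_of_notMem hf]
    rfl

lemma measurable_zeroCount_apply_of_isCompact {K : Set ℂ} (hK : IsCompact K) :
    Measurable (fun f => zeroCount f K) := by
  simp_rw [fun f => zeroCount_apply f hK.measurableSet]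
  exact (measurable_count_zeros hK).indicator measurableSet_locallyFiniteZeros

/-- Passing from closed sets to all Borel sets by a π-system argument requires finite measures:
hence the restriction to balls, and the value `0` of `zeroCount` when zeros accumulate. -/
lemma measurable_zeroCount_restrict (N : ℕ) :
    Measurable (fun f => (zeroCount f).restrict (Metric.closedBall 0 (N : ℝ))) := by
  have hfin (f : C(ℂ, ℂ)) :
      IsFiniteMeasure ((zeroCount f).restrict (Metric.closedBall 0 (N : ℝ))) := by
    refine ⟨?_⟩
    rw [Measure.restrict_apply_univ, zeroCount_apply f Metric.isClosed_closedBall.measurableSet]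
    by_cases hf : f ∈ locallyFiniteZeros
    · rw [Set.indicator_of_mem hf]; exact hf N
    · rw [Set.indicator_of_notMem hf]; exact ENNReal.zero_lt_top
  refine Measurable.measure_of_isPiSystem
    ((BorelSpace.measurable_eq (α := ℂ)).trans borel_eq_generateFrom_isClosed)
    isPiSystem_isClosed (fun s hs => ?_) ?_
  · have hs' : IsClosed s := hs
    simp_rw [Measure.restrict_apply hs'.measurableSet]
    exact measurable_zeroCount_apply_of_isCompact ((isCompact_closedBall _ _).inter_left hs')
  · simp_rw [Measure.restrict_apply_univ]
    exact measurable_zeroCount_apply_of_isCompact (isCompact_closedBall _ _)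

lemma measurable_zeroCount : Measurable zeroCount := by
  refine Measure.measurable_of_measurable_coe _ fun s hs => ?_
  have h (f : C(ℂ, ℂ)) :
      zeroCount f s = ⨆ N : ℕ, (zeroCount f).restrict (Metric.closedBall 0 (N : ℝ)) s := by
    rw [← Measure.restrict_iUnion_apply_eq_iSup _ hs, Metric.iUnion_closedBall_nat,
      Measure.restrict_univ]
    exact Monotone.directed_le fun m n hmn => Metric.closedBall_subset_closedBall (by gcongr)
  simp_rw [h]
  exact Measurable.iSup fun N => (Measure.measurable_coe hs).comp (measurable_zeroCount_restrict N)

/-- A random continuous function with locally finite zeros has a well defined point process of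
zeros, whose law is determined by that of the function. -/
lemma identDistrib_pointCount {Ω Ω' : Type*} [MeasurableSpace Ω] [MeasurableSpace Ω']
    {P : Measure Ω} {P' : Measure Ω'} {F : Ω → C(ℂ, ℂ)} {G : Ω' → C(ℂ, ℂ)}
    (h : IdentDistrib F G P P') (hF : ∀ᵐ x ∂P, F x ∈ locallyFiniteZeros) :
    IdentDistrib (fun x => pointCount {z | F x z = 0}) (fun y => pointCount {z | G y z = 0})
      P P' := by
  -- The map to zero configurations agrees with the measurable `zeroCount` wherever zeros are
  -- locally finite, hence almost everywhere for the law of `F`.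
  refine h.comp_of_aemeasurable (u := fun f : C(ℂ, ℂ) => pointCount {z | f z = 0})
    ⟨zeroCount, measurable_zeroCount, ?_⟩
  have h' := (ae_map_iff h.aemeasurable_fst measurableSet_locallyFiniteZeros).2 hF
  filter_upwards [h'] with f hf
  exact (if_pos hf).symm

/-- By the identity theorem the nonzero set is codiscrete, so its complement meets each compact ball
in a finite set. -/
lemma mem_locallyFiniteZeros_of_differentiable {f : C(ℂ, ℂ)} (hf : Differentiable ℂ f)
    (h0 : f 0 ≠ 0) : f ∈ locallyFiniteZeros := by
  intro N
  have ha : AnalyticOnNhd ℂ f Set.univ := fun z _ => hf.analyticAt z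
  rcases ha.eqOn_zero_or_eventually_ne_zero_of_preconnected isPreconnected_univ with h | h
  · exact absurd (h (Set.mem_univ 0)) h0
  · have h1 := Filter.codiscreteWithin_mono (Set.subset_univ (Metric.closedBall (0 : ℂ) N)) h
    have h2 := IsCompact.finite_sdiff_of_mem_codiscreteWithin (isCompact_closedBall (0 : ℂ) N) h1
    refine Measure.count_apply_lt_top.2 (h2.subset fun z hz => ⟨hz.2, ?_⟩)
    exact fun hne => hne hz.1

end WhiteNoise

end

/-! ### Proof of the proposition -/

open WhiteNoise
theorem mainTheorem1 {Ω Ω' : Type*} [MeasurableSpace Ω] [MeasurableSpace Ω']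
    (P : Measure Ω) [IsProbabilityMeasure P] (P' : Measure Ω') [IsProbabilityMeasure P']
    (ξ : ℕ → Ω → ℂ) (hξ : IsStdComplexGaussianSeq ξ P)
    (η : ℕ → Ω' → ℂ) (hη : IsStdComplexGaussianSeq η P') :
    -- the Gaussian STFT extends continuously to the space of white noise
    (Continuous noiseSTFT ∧
      ∀ s : Signal, noiseSTFT (toWeak hermiteBasis s : Weakened hermiteBasis) = gaussSTFT s) ∧
    -- the series defining white noise converges almost surely
    (∀ᵐ x ∂P, Tendsto (truncatedNoise hermiteBasis (fun k => ξ k x)) atTop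
      (𝓝 (whiteNoise hermiteBasis (fun k => ξ k x)))) ∧
    -- the planar GAF of parameter 1/2 is almost surely an entire function, sum of its series
    (∀ᵐ y ∂P', Differentiable ℂ (planarGAF (1 / 2) (fun k => η k y)) ∧
      ∀ z : ℂ, HasSum (fun k : ℕ => η k y * (√((1 / 2) ^ k / (k ! : ℝ)) : ℝ) * z ^ k)
        (planarGAF (1 / 2) (fun k => η k y) z)) ∧
    -- the factor does not vanish
    (∀ z : ℂ, stftFactor z ≠ 0) ∧
    -- equality in law of random continuous functions on the plane
    IdentDistrib (fun x => noiseSTFT (whiteNoise hermiteBasis (fun k => ξ k x)))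
      (fun y => stftFactor * planarGAF (1 / 2) (fun k => η k y)) P P' ∧
    -- the zeros of the spectrogram of white noise are those of a planar GAF ...
    (∃ ζ : ℕ → Ω → ℂ, IsStdComplexGaussianSeq ζ P ∧
      ∀ᵐ x ∂P,
        noiseSTFT (whiteNoise hermiteBasis (fun k => ξ k x))
          = stftFactor * planarGAF (1 / 2) (fun k => ζ k x) ∧
        {z : ℂ | spectrogram (noiseSTFT (whiteNoise hermiteBasis (fun k => ξ k x))) z = 0}
          = {z : ℂ | planarGAF (1 / 2) (fun k => ζ k x) z = 0}) ∧
    -- ... and have, as a point process, the same law as the zeros of any planar GAF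
    IdentDistrib
      (fun x => pointCount
        {z : ℂ | spectrogram (noiseSTFT (whiteNoise hermiteBasis (fun k => ξ k x))) z = 0})
      (fun y => pointCount {z : ℂ | planarGAF (1 / 2) (fun k => η k y) z = 0}) P P' := by
  have hSξ := ae_summable_of_hasLaw hξ.hasLaw
  have hSη := ae_summable_of_hasLaw hη.hasLaw
  have hF : (fun x => noiseSTFT (whiteNoise hermiteBasis (fun k => ξ k x)))
      =ᵐ[P] fun x => stftFactor * planarGAF (1 / 2) (fun k => (-Complex.I) ^ k * ξ k x) := by
    filter_upwards [hSξ] with x hx using noiseSTFT_whiteNoise hx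
  have hzeros (f : C(ℂ, ℂ)) :
      {z : ℂ | spectrogram (stftFactor * f) z = 0} = {z : ℂ | f z = 0} := by
    ext z
    simp [spectrogram, stftFactor_ne_zero]
  have hid := identDistrib_planarGAF hξ.rotate hη
  have hmul := hid.comp (u := fun f => stftFactor * f) (by fun_prop)
  refine ⟨⟨continuous_noiseSTFT, noiseSTFT_toWeak⟩, ?_, ?_, stftFactor_ne_zero, ?_, ?_, ?_⟩
  · filter_upwards [hSξ] with x hx using tendsto_truncatedNoise hermiteBasis hx
  · filter_upwards [hSη] with y hy using ⟨differentiable_planarGAF hy, hasSum_planarGAF hy⟩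
  -- The transform of white noise is almost everywhere measurable because it agrees almost surely
  -- with `ψ` times the rotated series.
  · exact (IdentDistrib.of_ae_eq (hmul.aemeasurable_fst.congr hF.symm) hF).trans hmul
  -- The witness is `ζₖ = (-i)ᵏ ξₖ`.
  · refine ⟨_, hξ.rotate, ?_⟩
    filter_upwards [hF] with x hx
    rw [hx]
    exact ⟨rfl, hzeros _⟩
  · have hfin : ∀ᵐ x ∂P,
        planarGAF (1 / 2) (fun k => (-Complex.I) ^ k * ξ k x) ∈ locallyFiniteZeros := by
      filter_upwards [ae_summable_of_hasLaw hξ.rotate.hasLaw, hξ.rotate.ae_planarGAF_ne_zero]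
        with x hx hx0
      exact mem_locallyFiniteZeros_of_differentiable (differentiable_planarGAF hx) hx0
    have hpc := identDistrib_pointCount hid hfin
    refine (IdentDistrib.of_ae_eq (hpc.aemeasurable_fst.congr ?_) ?_).trans hpc
    all_goals
      filter_upwards [hF] with x hx
      rw [hx, hzeros]
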